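/- Let $m\ge 1$, let $K\subset\mathbb C^m$ be compact, let $Q:K\to\mathbb R$ be continuous, and let $\tau$ be a Borel probability measure on $K$ such that $(K,Q,\tau)$ has the weighted Bernstein–Markov property: there are constants $M_n\geq 0$ with $\limsup_{n\to\infty}M_n^{1/n}=1$ and $$\max_{z\in K}|p(z)|e^{-nQ(z)}\le M_n\Big(\int_K|p|^2e^{-2nQ}\,d\tau\Big)^{1/2}$$ for every $n\ge1$ and every $p\in\mathcal P_n$, the space of complex polynomials in $m$ variables of degree at most $n$. Let $$V_{K,Q}(z):=\sup\Big\{\tfrac1{\deg p}\log|p(z)|\ :\ p \text{ a polynomial},\ \deg p\ge1,\ \max_{w\in K}|p(w)|e^{-(\deg p)\,Q(w)}\le1\Big\}$$ and assume that $V_{K,Q}$ is real-valued and continuous on $\mathbb C^m$. For each $n\ge1$ let $\{p^{(n)}_\nu\}_{|\nu|\le n}$ be an orthonormal basis of $\mathcal P_n$ in $L^2(e^{-2nQ}\tau)$, and consider the random polynomials $$H_n(z)=\sum_{|\nu|\le n}a^{(n)}_\nu p^{(n)}_\nu(z),$$ where the $a^{(n)}_\nu$ are i.i.d. real random variables with density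 $\phi(x)=\pi^{-1/2}e^{-x^2}$ on $\mathbb R$. For a locally integrable function $u$ on $\mathbb C^m$ let $dd^cu$, with $dd^c=\frac i\pi\partial\overline\partial$, be the current $(dd^cu,\alpha)=\int_{\mathbb C^m}u\,dd^c\alpha$, acting on smooth compactly supported $(m-1,m-1)$-forms $\alpha$. Then, for each $n\ge1$, $\log|H_n|$ is almost surely locally integrable, so that the normalized zero current $\tilde Z_{H_n}=\frac1n dd^c\log|H_n|$ is almost surely defined; for each $\alpha$ the random variable $(\tilde Z_{H_n},\alpha)$ is integrable, so that the expected current $(E(\tilde Z_{H_n}),\alpha):=\mathbb E\big[(\tilde Z_{H_n},\alpha)\big]$ is defined; and $$\lim_{n\to\infty}E(\tilde Z_{H_n})=dd^cV_{K,Q}$$ as currents, i.e. $(E(\tilde Z_{H_n}),\alpha)\to(dd^cV_{K,Q},\alpha)$ for every smooth compactly supported $(m-1,m-1)$-form $\alpha$. -/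

import Mathlib

open MeasureTheory ProbabilityTheory Filter Topology
open scoped ENNReal NNReal ContDiff

noncomputable section

namespace ExpectedZeros

/-! ### Weighted pluripotential theory -/

/-- The weighted extremal function
`V_{K,Q}(z) = sup { (1 / deg p) log |p(z)| : deg p ≥ 1, ‖p e^{-(deg p) Q}‖_K ≤ 1 }`,
with values in `[-∞, +∞]` and with `log 0 = -∞`. -/
def extremalFunction {m : ℕ} (K : Set (Fin m → ℂ)) (Q : (Fin m → ℂ) → ℝ) (z : Fin m → ℂ) :
    EReal :=
  ⨆ (p : MvPolynomial (Fin m) ℂ) (_ : 1 ≤ p.totalDegree)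
    (_ : ∀ w ∈ K, ‖MvPolynomial.eval w p‖ * Real.exp (-(p.totalDegree * Q w)) ≤ 1),
    ENNReal.log ‖MvPolynomial.eval z p‖ₑ / (p.totalDegree : EReal)

/-- The weighted Bernstein-Markov property of `(K, Q, τ)`: there are constants `M n` with
`limsup (M n)^(1/n) = 1` and `‖p e^{-nQ}‖_K ≤ M n * ‖p e^{-nQ}‖_{L²(τ)}` whenever
`n ≥ 1` and `deg p ≤ n`. -/
def WeightedBernsteinMarkov {m : ℕ} (K : Set (Fin m → ℂ)) (Q : (Fin m → ℂ) → ℝ)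
    (τ : Measure (Fin m → ℂ)) : Prop :=
  ∃ M : ℕ → ℝ≥0,
    limsup (fun n : ℕ => (M n : ℝ≥0∞) ^ (1 / (n : ℝ))) atTop = 1 ∧
    ∀ n : ℕ, 1 ≤ n → ∀ p : MvPolynomial (Fin m) ℂ, p.totalDegree ≤ n → ∀ z ∈ K,
      ‖MvPolynomial.eval z p‖ * Real.exp (-(n * Q z)) ≤
        M n * Real.sqrt (∫ w in K, ‖MvPolynomial.eval w p‖ ^ 2 * Real.exp (-(2 * n * Q w)) ∂τ)

/-- The multi-indices `ν = (ν₁, …, ν_m)` with `|ν| ≤ n`. -/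
abbrev MultiIndex (m n : ℕ) : Type :=
  {ν : Fin m → Fin (n + 1) // ∑ i, (ν i : ℕ) ≤ n}

/-- `(b_ν)_{|ν| ≤ n}` is an orthonormal basis, in `L²(e^{-2nQ} τ)`, of the space of polynomials of
degree at most `n`. -/
structure IsOrthonormalBasis {m : ℕ} (K : Set (Fin m → ℂ)) (Q : (Fin m → ℂ) → ℝ)
    (τ : Measure (Fin m → ℂ)) (n : ℕ) (b : MultiIndex m n → MvPolynomial (Fin m) ℂ) : Prop where
  span_eq : Submodule.span ℂ (Set.range b) = MvPolynomial.restrictTotalDegree (Fin m) ℂ n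
  orthonormal : ∀ ν γ : MultiIndex m n,
    ∫ w in K, MvPolynomial.eval w (b ν) * (starRingEnd ℂ) (MvPolynomial.eval w (b γ)) *
      (Real.exp (-(2 * n * Q w)) : ℂ) ∂τ = if ν = γ then 1 else 0

/-! ### Forms and currents on `ℂ^m` -/

/-- Complex-valued exterior forms of degree `k` (real-multilinear) at a point of `ℂ^m`. -/
abbrev Form (m k : ℕ) : Type := (Fin m → ℂ) [⋀^Fin k]→L[ℝ] ℂ

/-- A form has bidegree `(p, q)` if `p + q` is its degree and scaling all its arguments by a complex
number `c` multiplies it by `c^p (conj c)^q`. -/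
def IsBidegree {m k : ℕ} (p q : ℕ) (η : Form m k) : Prop :=
  p + q = k ∧ ∀ (c : ℂ) (v : Fin k → Fin m → ℂ),
    η (fun j => c • v j) = c ^ p * (starRingEnd ℂ) c ^ q * η v

/-- Test forms of bidegree `(p, q)` on `ℂ^m`: coefficients are smooth with compact support. -/
structure TestForm (m p q : ℕ) where
  toFun : (Fin m → ℂ) → Form m (p + q)
  smooth : ContDiff ℝ ∞ toFun
  compactSupport : HasCompactSupport toFun
  bidegree : ∀ z, IsBidegree p q (toFun z)

/-- Multiplication by `i` on `ℂ^m`, as a real-linear map. -/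
def mulI (m : ℕ) : (Fin m → ℂ) →L[ℝ] (Fin m → ℂ) :=
  Complex.I • ContinuousLinearMap.id ℝ (Fin m → ℂ)

/-- The operator `dd^c = (i/π) ∂ ∂̄` on forms of bidegree `(p, p)`. If `α` has bidegree `(p, p)`,
then composing `dα = ∂α + ∂̄α` with multiplication by `i` in all arguments gives `i (∂α - ∂̄α)`,
whose exterior derivative is `-2 i ∂ ∂̄ α`. -/
def ddc {m k : ℕ} (α : (Fin m → ℂ) → Form m k) (z : Fin m → ℂ) : Form m (k + 1 + 1) :=
  (-(1 / (2 * Real.pi)) : ℝ) •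
    extDeriv (fun w => (extDeriv α w).compContinuousLinearMap (mulI m)) z

/-- The positively oriented real frame `e₁, i e₁, e₂, i e₂, …, e_m, i e_m` of `ℂ^m` (used with
`k = 2m`), so that `dx₁ ∧ dy₁ ∧ ⋯ ∧ dx_m ∧ dy_m` takes the value `1` on it. -/
def frame (m k : ℕ) : Fin k → Fin m → ℂ := fun j i =>
  if (i : ℕ) = (j : ℕ) / 2 then (if (j : ℕ) % 2 = 0 then 1 else Complex.I) else 0

/-- The value of the current `dd^c u` on a test form `α` of bidegree `(m-1, m-1)`:
`(dd^c u, α) = ∫_{ℂ^m} u dd^c α`. -/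
def ddcCurrent {m : ℕ} (u : (Fin m → ℂ) → ℝ) (α : TestForm m (m - 1) (m - 1)) : ℂ :=
  ∫ z, (u z : ℂ) * ddc α.toFun z (frame m _)

/-! ### Random polynomials -/

/-- The law on `ℝ` with density `π^{-1/2} e^{-x²}`. -/
def gaussianLaw : Measure ℝ :=
  volume.withDensity fun x => ENNReal.ofReal (1 / Real.sqrt Real.pi * Real.exp (-x ^ 2))

/-- `H(z) = ∑_{|ν| ≤ n} a_ν b_ν(z)` for real coefficients `a_ν`. -/
def polySum {m n : ℕ} (b : MultiIndex m n → MvPolynomial (Fin m) ℂ) (a : MultiIndex m n → ℝ)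
    (z : Fin m → ℂ) : ℂ :=
  ∑ ν, (a ν : ℂ) * MvPolynomial.eval z (b ν)

/-- The normalized zero current `(1/n) dd^c log |H|`. -/
def normalizedZeroCurrent {m : ℕ} (n : ℕ) (H : (Fin m → ℂ) → ℂ)
    (α : TestForm m (m - 1) (m - 1)) : ℂ :=
  (1 / (n : ℂ)) * ddcCurrent (fun z => Real.log ‖H z‖) α

/-- The expectation of the normalized zero current of the random polynomial `H`:
`(E(Z), α) = ∫ (Z(x), α) dP(x)`. -/
def expectedNormalizedZeroCurrent {m : ℕ} {Ω : Type*} [MeasurableSpace Ω] (P : Measure Ω) (n : ℕ)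
    (H : Ω → (Fin m → ℂ) → ℂ) (α : TestForm m (m - 1) (m - 1)) : ℂ :=
  ∫ x, normalizedZeroCurrent n (H x) α ∂P

end ExpectedZeros

end

open ExpectedZeros

namespace ExpectedZeros

/-! ### Logarithms of complex combinations of independent real Gaussian variables -/

/-! Pairing with `α` means integrating against `g`, the coefficient of `dd^c α`, which is continuous
with compact support. By Fubini the claim becomes the convergence of `∫ (1/n) E log|H_n| g` to `∫ V
g`. Let `S_n(z) = ∑ |b_ν(z)|²` be the diagonal of the Bergman kernel.

Probability: at a fixed `z`, `H_n(z)` is a complex combination of real Gaussians. Its law depends on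
the phases of the coefficients, so no unitary invariance is available. Still, `E |log|H_n(z)| -
(1/2) log S_n(z)|` is bounded by an absolute constant (`integral_abs_log_norm_sum_sub_le`): the real
or the imaginary part carries at least half of the variance and controls the logarithm from below.
After division by `n` the randomness disappears.

Pluripotential theory: `(1/2n) log S_n → V` pointwise (`tendsto_log_bergmanDiagonal`). For the upper
bound, Bernstein–Markov makes each `b_ν` almost a competitor for `V`, and there are only
polynomially many of them. For the lower bound, powers of a competitor are tested in the extremal
inequality `|p(z)|² ≤ ‖p‖² S_n(z)`.

Bounds uniform in `n` then permit dominated convergence. -/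

theorem gaussianLaw_eq_gaussianReal : gaussianLaw = gaussianReal 0 (1 / 2) := by
  rw [gaussianReal_of_var_ne_zero _ (by norm_num), gaussianLaw]
  congr 1
  ext x
  rw [gaussianPDF, gaussianPDFReal]
  congr 1
  have h : (2 * Real.pi * ((1 / 2 : ℝ≥0) : ℝ)) = Real.pi := by push_cast; ring
  rw [h]
  congr 1
  · rw [one_div]
  · congr 1
    push_cast
    ring

instance isProbabilityMeasure_gaussianLaw : IsProbabilityMeasure gaussianLaw := by
  rw [gaussianLaw_eq_gaussianReal]
  infer_instance

/-- Apply `log t ≤ t - 1` to `|x|` and to `|x|^(-1/2)`. The exponent lies above `-1`, so the bound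
stays integrable at `0`. -/
theorem abs_log_le_abs_add_rpow {x : ℝ} (hx : x ≠ 0) :
    |Real.log x| ≤ |x| + 2 * |x| ^ (-(1 / 2) : ℝ) := by
  have h0 : 0 < |x| := abs_pos.2 hx
  have h1 : 0 < |x| ^ (-(1 / 2) : ℝ) := Real.rpow_pos_of_pos h0 _
  rw [← Real.log_abs, abs_le]
  constructor
  · have h2 := Real.log_le_sub_one_of_pos h1
    rw [Real.log_rpow h0] at h2
    linarith
  · have h2 := Real.log_le_sub_one_of_pos h0
    linarith

theorem integrable_abs_rpow_mul_exp_neg_sq {s : ℝ} (hs : -1 < s) :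
    Integrable fun x : ℝ => |x| ^ s * Real.exp (-x ^ 2) := by
  have h : IntegrableOn (fun x : ℝ => |x| ^ s * Real.exp (-x ^ 2)) (Set.Ioi 0) := by
    refine ((integrable_rpow_mul_exp_neg_mul_sq one_pos hs).integrableOn).congr_fun
      (fun x hx => ?_) measurableSet_Ioi
    simp [abs_of_pos (Set.mem_Ioi.1 hx)]
  have h' : IntegrableOn (fun x : ℝ => |x| ^ s * Real.exp (-x ^ 2)) (Set.Iio 0) := by
    have := h.comp_neg
    simpa using this
  rw [← integrableOn_univ, ← Set.Iio_union_Ici (a := (0 : ℝ))]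
  exact h'.union ((integrableOn_Ici_iff_integrableOn_Ioi (by simp)).2 h)

theorem integrable_log_gaussianLaw : Integrable Real.log gaussianLaw := by
  rw [gaussianLaw, integrable_withDensity_iff_integrable_smul' (by fun_prop)
    (ae_of_all _ fun _ => ENNReal.ofReal_lt_top)]
  have h1 := integrable_abs_rpow_mul_exp_neg_sq (s := 1) (by norm_num)
  have h2 := integrable_abs_rpow_mul_exp_neg_sq (s := -(1 / 2)) (by norm_num)
  refine ((h1.add (h2.const_mul 2)).const_mul (1 / Real.sqrt Real.pi)).mono'
    (by fun_prop) ?_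
  filter_upwards [compl_mem_ae_iff.2 (measure_singleton (0 : ℝ))] with x hx
  have h3 := abs_log_le_abs_add_rpow (x := x) hx
  have h4 : 0 ≤ 1 / Real.sqrt Real.pi * Real.exp (-x ^ 2) := by positivity
  rw [ENNReal.toReal_ofReal h4, norm_smul, Real.norm_of_nonneg h4, Real.norm_eq_abs]
  calc _ ≤ 1 / Real.sqrt Real.pi * Real.exp (-x ^ 2) * (|x| + 2 * |x| ^ (-(1 / 2) : ℝ)) := by
        gcongr
    _ = _ := by simp only [Pi.add_apply, Real.rpow_one]; ring

section GaussianSum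

variable {Ω ι : Type*} [MeasurableSpace Ω] [Fintype ι] {P : Measure Ω} {a : ι → Ω → ℝ}

theorem hasLaw_gaussianReal_sum_mul [IsProbabilityMeasure P] (ha_meas : ∀ i, Measurable (a i))
    (ha_indep : iIndepFun a P) (ha_law : ∀ i, P.map (a i) = gaussianLaw) (r : ι → ℝ) :
    HasLaw (fun x => ∑ i, a i x * r i) (gaussianReal 0 (Real.toNNReal ((∑ i, r i ^ 2) / 2))) P := by
  have hl : ∀ i, HasLaw (a i) (gaussianReal 0 (1 / 2)) P := fun i =>
    ⟨(ha_meas i).aemeasurable, by rw [ha_law, gaussianLaw_eq_gaussianReal]⟩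
  have hl' : ∀ i, HasLaw (fun x => a i x * r i) _ P := fun i =>
    gaussianReal_mul_const (hl i) (r i)
  have hind : iIndepFun (fun i x => a i x * r i) P :=
    ha_indep.comp (fun i y => y * r i) (fun i => by fun_prop)
  have hG : HasGaussianLaw (fun x => ∑ i, a i x * r i) P :=
    iIndepFun.hasGaussianLaw_fun_sum (fun i => (hl' i).hasGaussianLaw) hind
  have hmem : ∀ i, MemLp (fun x => a i x * r i) 2 P := fun i =>
    (hl' i).hasGaussianLaw.memLp_two
  refine ⟨hG.aemeasurable, ?_⟩
  rw [hG.map_eq_gaussianReal]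
  congr 1
  · rw [integral_finsetSum _ fun i _ => (hmem i).integrable one_le_two]
    refine Finset.sum_eq_zero fun i _ => ?_
    rw [(hl' i).integral_eq]
    simp
  · congr 1
    have := IndepFun.variance_sum (s := Finset.univ) (fun i _ => hmem i)
      (fun i _ j _ hij => hind.indepFun hij)
    rw [show (∑ i, fun x => a i x * r i) = fun x => ∑ i, a i x * r i by
      ext x; simp] at this
    rw [this, Finset.sum_div]
    refine Finset.sum_congr rfl fun i _ => ?_
    rw [(hl' i).variance_eq]
    simp
    ring

theorem integrable_sq_sum_mul [IsProbabilityMeasure P] (ha_meas : ∀ i, Measurable (a i))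
    (ha_indep : iIndepFun a P) (ha_law : ∀ i, P.map (a i) = gaussianLaw) (r : ι → ℝ) :
    Integrable (fun x => (∑ i, a i x * r i) ^ 2) P :=
  (hasLaw_gaussianReal_sum_mul ha_meas ha_indep ha_law r).hasGaussianLaw.memLp_two.integrable_sq

theorem integral_sq_sum_mul [IsProbabilityMeasure P] (ha_meas : ∀ i, Measurable (a i))
    (ha_indep : iIndepFun a P) (ha_law : ∀ i, P.map (a i) = gaussianLaw) (r : ι → ℝ) :
    ∫ x, (∑ i, a i x * r i) ^ 2 ∂P = (∑ i, r i ^ 2) / 2 := by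
  have hl := hasLaw_gaussianReal_sum_mul ha_meas ha_indep ha_law r
  have h := hl.variance_eq
  rw [variance_of_integral_eq_zero hl.aemeasurable (by rw [hl.integral_eq]; simp)] at h
  rw [h]
  simp [Finset.sum_nonneg, sq_nonneg, div_nonneg]

theorem hasLaw_gaussianLaw_sum_mul_div [IsProbabilityMeasure P] (ha_meas : ∀ i, Measurable (a i))
    (ha_indep : iIndepFun a P) (ha_law : ∀ i, P.map (a i) = gaussianLaw) (r : ι → ℝ)
    (hr : 0 < ∑ i, r i ^ 2) :
    HasLaw (fun x => (∑ i, a i x * r i) / √(∑ i, r i ^ 2)) gaussianLaw P := by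
  have h := gaussianReal_div_const (hasLaw_gaussianReal_sum_mul ha_meas ha_indep ha_law r)
    (√(∑ i, r i ^ 2))
  rw [gaussianLaw_eq_gaussianReal]
  convert h using 2
  · simp
  · ext
    have : (0 : ℝ) ≤ (∑ i, r i ^ 2) / 2 := by positivity
    simp [Real.sq_sqrt hr.le, Real.coe_toNNReal _ this]
    field_simp

/-- Pointwise form of the estimate: `x` stands for the real or imaginary part of `w`, and `s` for
its share of `S`. Above, use `log t ≤ t - 1` with `t = ‖w‖² / S`; below, use `‖w‖² / S ≥ (x / √s)² /
2`. -/
theorem abs_log_norm_sub_le {w : ℂ} {x s S : ℝ} (hs : 0 < s) (hS : S ≤ 2 * s)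
    (hS' : 0 < S) (hx : x ≠ 0) (hxw : x ^ 2 ≤ ‖w‖ ^ 2) :
    |Real.log ‖w‖ - 1 / 2 * Real.log S| ≤
      1 / 2 * (‖w‖ ^ 2 / S) + |Real.log (x / √s)| + 1 / 2 * Real.log 2 := by
  have hx2 : 0 < x ^ 2 := by positivity
  have hw2 : 0 < ‖w‖ ^ 2 := hx2.trans_le hxw
  have e1 : Real.log ‖w‖ - 1 / 2 * Real.log S = 1 / 2 * Real.log (‖w‖ ^ 2 / S) := by
    rw [Real.log_div hw2.ne' hS'.ne', Real.log_pow]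
    push_cast
    ring
  have e2 : Real.log (x ^ 2 / s / 2) = 2 * Real.log (x / √s) - Real.log 2 := by
    rw [Real.log_div (by positivity) (by norm_num)]
    rw [show x ^ 2 / s = (x / √s) ^ 2 by rw [div_pow, Real.sq_sqrt hs.le], Real.log_pow]
    push_cast
    ring
  have h2 : 0 ≤ Real.log 2 := Real.log_nonneg (by norm_num)
  rw [e1, abs_le]
  constructor
  · have h3 : Real.log (x ^ 2 / s / 2) ≤ Real.log (‖w‖ ^ 2 / S) := by
      refine Real.log_le_log (by positivity) ?_
      rw [div_div]
      gcongr
      linarith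
    have h4 := neg_abs_le (Real.log (x / √s))
    have h5 : 0 ≤ ‖w‖ ^ 2 / S := by positivity
    linarith
  · have h3 := Real.log_le_sub_one_of_pos (div_pos hw2 hS')
    have h4 := abs_nonneg (Real.log (x / √s))
    linarith

/-- A bound for `E |log |Z| - log ‖Z‖₂|`, uniform over the complex linear combinations `Z` of
independent variables of law `gaussianLaw`. -/
noncomputable def logGaussianBound : ℝ :=
  1 / 4 + (∫ y, |Real.log y| ∂gaussianLaw) + 1 / 2 * Real.log 2

/-- Integrate the pointwise bound: `E ‖Z‖² = S / 2` produces the term `1/4`, and the normalised real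
part has law `gaussianLaw` whatever `c` is, which makes the bound uniform. -/
theorem integral_abs_log_norm_sum_sub_le [IsProbabilityMeasure P]
    (ha_meas : ∀ i, Measurable (a i)) (ha_indep : iIndepFun a P)
    (ha_law : ∀ i, P.map (a i) = gaussianLaw) (c : ι → ℂ) (hc : 0 < ∑ i, ‖c i‖ ^ 2) :
    Integrable (fun x => Real.log ‖∑ i, (a i x : ℂ) * c i‖) P ∧
      ∫ x, |Real.log ‖∑ i, (a i x : ℂ) * c i‖ - 1 / 2 * Real.log (∑ i, ‖c i‖ ^ 2)| ∂P ≤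
        logGaussianBound := by
  set S := ∑ i, ‖c i‖ ^ 2 with hS
  have hre : ∀ x, (∑ i, (a i x : ℂ) * c i).re = ∑ i, a i x * (c i).re := fun x => by simp
  have him : ∀ x, (∑ i, (a i x : ℂ) * c i).im = ∑ i, a i x * (c i).im := fun x => by simp
  have hnorm : ∀ w : ℂ, ‖w‖ ^ 2 = w.re ^ 2 + w.im ^ 2 := fun w => by
    rw [Complex.sq_norm, Complex.normSq_apply]; ring
  have hsum : S = ∑ i, (c i).re ^ 2 + ∑ i, (c i).im ^ 2 := by
    rw [hS, ← Finset.sum_add_distrib]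
    exact Finset.sum_congr rfl fun i _ => hnorm _
  have hint2 : Integrable (fun x => ‖∑ i, (a i x : ℂ) * c i‖ ^ 2) P := by
    simp only [hnorm, hre, him]
    exact (integrable_sq_sum_mul ha_meas ha_indep ha_law _).add
      (integrable_sq_sum_mul ha_meas ha_indep ha_law _)
  have hI2 : ∫ x, ‖∑ i, (a i x : ℂ) * c i‖ ^ 2 ∂P = S / 2 := by
    simp only [hnorm, hre, him]
    rw [integral_add (integrable_sq_sum_mul ha_meas ha_indep ha_law _)
      (integrable_sq_sum_mul ha_meas ha_indep ha_law _),
      integral_sq_sum_mul ha_meas ha_indep ha_law, integral_sq_sum_mul ha_meas ha_indep ha_law,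
      hsum]
    ring
  -- Take `r = Re c` or `r = Im c`, whichever has the larger sum of squares. The choice is
  -- deterministic, so the law of `∑ a_i r_i` is known.
  obtain ⟨r, hr, hrS⟩ : ∃ r : ι → ℝ,
      (∀ x, (∑ i, a i x * r i) ^ 2 ≤ ‖∑ i, (a i x : ℂ) * c i‖ ^ 2) ∧ S ≤ 2 * ∑ i, r i ^ 2 := by
    rcases le_total (∑ i, (c i).re ^ 2) (∑ i, (c i).im ^ 2) with h | h
    · refine ⟨fun i => (c i).im, fun x => ?_, by linarith⟩
      rw [hnorm, him]
      nlinarith [sq_nonneg (∑ i, (a i x : ℂ) * c i).re]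
    · refine ⟨fun i => (c i).re, fun x => ?_, by linarith⟩
      rw [hnorm, hre]
      nlinarith [sq_nonneg (∑ i, (a i x : ℂ) * c i).im]
  have hs : 0 < ∑ i, r i ^ 2 := by linarith
  have hZ := hasLaw_gaussianLaw_sum_mul_div ha_meas ha_indep ha_law r hs
  -- The lower bound fails where `log 0 = 0` intervenes; a nondegenerate Gaussian has no atom there.
  have hZ0 : ∀ᵐ x ∂P, ∑ i, a i x * r i ≠ 0 := by
    have h0 : gaussianLaw {0} = 0 := by
      rw [gaussianLaw_eq_gaussianReal]
      have := nullSingletonClass_gaussianReal (μ := 0) (v := 1 / 2) (by norm_num)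
      exact measure_singleton 0
    rw [← hZ.map_eq] at h0
    have h1 := ae_of_ae_map hZ.aemeasurable (compl_mem_ae_iff.2 h0)
    filter_upwards [h1] with x hx h
    exact hx (by simp [h])
  have hlogZ : Integrable (fun x => |Real.log ((∑ i, a i x * r i) / √(∑ i, r i ^ 2))|) P :=
    Integrable.comp_aemeasurable (g := fun y => |Real.log y|)
      (hZ.map_eq.symm ▸ integrable_log_gaussianLaw.abs) hZ.aemeasurable
  have hIlogZ : ∫ x, |Real.log ((∑ i, a i x * r i) / √(∑ i, r i ^ 2))| ∂P =
      ∫ y, |Real.log y| ∂gaussianLaw :=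
    hZ.integral_comp (f := fun y => |Real.log y|) (by fun_prop)
  set B : Ω → ℝ := fun x => 1 / 2 * (‖∑ i, (a i x : ℂ) * c i‖ ^ 2 / S) +
    |Real.log ((∑ i, a i x * r i) / √(∑ i, r i ^ 2))| + 1 / 2 * Real.log 2
  have hBint : Integrable B P :=
    (((hint2.div_const S).const_mul _).add hlogZ).add (integrable_const _)
  have hle : ∀ᵐ x ∂P,
      |Real.log ‖∑ i, (a i x : ℂ) * c i‖ - 1 / 2 * Real.log S| ≤ B x := by
    filter_upwards [hZ0] with x hx
    exact abs_log_norm_sub_le hs hrS hc hx (hr x)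
  have hdiff : Integrable
      (fun x => Real.log ‖∑ i, (a i x : ℂ) * c i‖ - 1 / 2 * Real.log S) P :=
    hBint.mono' (Measurable.aestronglyMeasurable (by fun_prop)) hle
  refine ⟨(hdiff.add (integrable_const (1 / 2 * Real.log S))).congr
    (ae_of_all _ fun x => sub_add_cancel _ _), ?_⟩
  refine (integral_mono_ae hdiff.abs hBint hle).trans_eq ?_
  have h1 : Integrable (fun x => 1 / 2 * (‖∑ i, (a i x : ℂ) * c i‖ ^ 2 / S)) P :=
    (hint2.div_const S).const_mul _
  have h2 : Integrable (fun x => 1 / 2 * (‖∑ i, (a i x : ℂ) * c i‖ ^ 2 / S) +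
      |Real.log ((∑ i, a i x * r i) / √(∑ i, r i ^ 2))|) P := h1.add hlogZ
  rw [integral_add h2 (integrable_const _), integral_add h1 hlogZ,
    integral_const_mul, integral_div, hI2,
    hIlogZ, logGaussianBound]
  simp
  field_simp
  norm_num

end GaussianSum

/-! ### Polynomial growth and the weighted extremal function -/

theorem _root_.MvPolynomial.totalDegree_smul_of_ne_zero {σ F : Type*} [Field F] {c : F} (hc : c ≠ 0)
    (p : MvPolynomial σ F) : (c • p).totalDegree = p.totalDegree := by
  refine le_antisymm (MvPolynomial.totalDegree_smul_le c p) ?_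
  conv_lhs => rw [← inv_smul_smul₀ hc p]
  exact MvPolynomial.totalDegree_smul_le _ _

theorem _root_.ENNReal.log_enorm_div_natCast {w : ℂ} (hw : w ≠ 0) (d : ℕ) :
    ENNReal.log ‖w‖ₑ / (d : EReal) = ((Real.log ‖w‖ / d : ℝ) : EReal) := by
  rw [← ofReal_norm, ENNReal.log_ofReal_of_pos (norm_pos_iff.2 hw), EReal.coe_div]
  rfl

section Growth

variable {m : ℕ} {K : Set (Fin m → ℂ)} {Q V : (Fin m → ℂ) → ℝ}

/-- Bernstein–Walsh inequality: `C⁻¹ p` is a competitor for `V`. The degree must be exactly `n`,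
because the weight in `V` is tied to the degree. -/
theorem norm_eval_le_exp_of_totalDegree_eq (hV : ∀ z, extremalFunction K Q z = (V z : EReal))
    {n : ℕ} (hn : 1 ≤ n) {p : MvPolynomial (Fin m) ℂ} (hp : p.totalDegree = n) {C : ℝ}
    (hC : 0 < C) (hpK : ∀ w ∈ K, ‖MvPolynomial.eval w p‖ * Real.exp (-(n * Q w)) ≤ C)
    (z : Fin m → ℂ) : ‖MvPolynomial.eval z p‖ ≤ C * Real.exp (n * V z) := by
  by_cases h0 : MvPolynomial.eval z p = 0
  · rw [h0, norm_zero]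
    positivity
  have hC' : ((C⁻¹ : ℝ) : ℂ) ≠ 0 := by simpa using hC.ne'
  have hdeg := (MvPolynomial.totalDegree_smul_of_ne_zero hC' p).trans hp
  have heval : ∀ w, ‖MvPolynomial.eval w (((C⁻¹ : ℝ) : ℂ) • p)‖ =
      C⁻¹ * ‖MvPolynomial.eval w p‖ := fun w => by
    rw [MvPolynomial.smul_eval, norm_mul, Complex.norm_real, Real.norm_of_nonneg (by positivity)]
  have h1 : ENNReal.log ‖MvPolynomial.eval z (((C⁻¹ : ℝ) : ℂ) • p)‖ₑ /
      ((((C⁻¹ : ℝ) : ℂ) • p).totalDegree : EReal) ≤ (V z : EReal) := by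
    rw [← hV z, extremalFunction]
    refine le_iSup₂_of_le (((C⁻¹ : ℝ) : ℂ) • p) (by rwa [hdeg]) (le_iSup_of_le ?_ le_rfl)
    intro w hw
    rw [hdeg, heval, mul_assoc, inv_mul_le_iff₀ hC, mul_one]
    exact hpK w hw
  have hn0 : (0 : ℝ) < n := by exact_mod_cast hn
  have hz : 0 < ‖MvPolynomial.eval z p‖ := norm_pos_iff.2 h0
  rw [ENNReal.log_enorm_div_natCast (by rw [MvPolynomial.smul_eval]; exact mul_ne_zero hC' h0),
    hdeg, EReal.coe_le_coe_iff, heval, div_le_iff₀ hn0,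
    Real.log_le_iff_le_exp (by positivity), inv_mul_le_iff₀ hC] at h1
  rwa [mul_comm (n : ℝ)]

/-- A polynomial of lower degree carries the wrong weight for `V`. Adding `ε z_i^n` raises its
degree to `n` at a cost `O(ε)` on `K`; then `ε → 0`. -/
theorem norm_eval_le_exp (hm : 1 ≤ m) (hK : IsCompact K) (hQ : ContinuousOn Q K)
    (hV : ∀ z, extremalFunction K Q z = (V z : EReal))
    {n : ℕ} (hn : 1 ≤ n) {p : MvPolynomial (Fin m) ℂ} (hp : p.totalDegree ≤ n) {C : ℝ}
    (hC : 0 < C) (hpK : ∀ w ∈ K, ‖MvPolynomial.eval w p‖ * Real.exp (-(n * Q w)) ≤ C)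
    (z : Fin m → ℂ) : ‖MvPolynomial.eval z p‖ ≤ C * Real.exp (n * V z) := by
  rcases hp.eq_or_lt with hp | hp
  · exact norm_eval_le_exp_of_totalDegree_eq hV hn hp hC hpK z
  set i : Fin m := ⟨0, hm⟩
  obtain ⟨D, hD⟩ := hK.exists_bound_of_continuousOn
    (f := fun w => w i ^ n * (Real.exp (-(n * Q w)) : ℂ)) (by fun_prop)
  have key : ∀ ε : ℝ, 0 < ε →
      ‖MvPolynomial.eval z p + ε * z i ^ n‖ ≤ (C + ε * |D|) * Real.exp (n * V z) := by
    intro ε hε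
    have hdeg : (((ε : ℝ) : ℂ) • (MvPolynomial.X i : MvPolynomial (Fin m) ℂ) ^ n).totalDegree =
        n := by
      rw [MvPolynomial.totalDegree_smul_of_ne_zero (by exact_mod_cast hε.ne'),
        MvPolynomial.totalDegree_X_pow]
    have heval : ∀ w, MvPolynomial.eval w (p + ((ε : ℝ) : ℂ) • MvPolynomial.X i ^ n) =
        MvPolynomial.eval w p + ε * w i ^ n := fun w => by
      rw [map_add, MvPolynomial.smul_eval, map_pow, MvPolynomial.eval_X]
    rw [← heval]
    refine norm_eval_le_exp_of_totalDegree_eq hV hn ?_ (by positivity) ?_ z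
    · rw [MvPolynomial.totalDegree_add_eq_right_of_totalDegree_lt (by rwa [hdeg]), hdeg]
    · intro w hw
      have h1 := hD w hw
      rw [norm_mul, Complex.norm_real, Real.norm_of_nonneg (Real.exp_pos _).le] at h1
      calc _ ≤ (‖MvPolynomial.eval w p‖ + ε * ‖w i ^ n‖) * Real.exp (-(n * Q w)) := by
            rw [heval]
            gcongr
            refine (norm_add_le _ _).trans_eq ?_
            rw [norm_mul, Complex.norm_real, Real.norm_of_nonneg hε.le]
        _ = ‖MvPolynomial.eval w p‖ * Real.exp (-(n * Q w)) +
            ε * (‖w i ^ n‖ * Real.exp (-(n * Q w))) := by ring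
        _ ≤ C + ε * |D| := by
            gcongr
            · exact hpK w hw
            · exact h1.trans (le_abs_self D)
  have hl : Tendsto (fun ε : ℝ => ‖MvPolynomial.eval z p + ε * z i ^ n‖) (𝓝[>] 0)
      (𝓝 ‖MvPolynomial.eval z p + (0 : ℝ) * z i ^ n‖) :=
    (Continuous.tendsto (by fun_prop) 0).mono_left nhdsWithin_le_nhds
  have hr : Tendsto (fun ε : ℝ => (C + ε * |D|) * Real.exp (n * V z)) (𝓝[>] 0)
      (𝓝 ((C + 0 * |D|) * Real.exp (n * V z))) :=
    (Continuous.tendsto (by fun_prop) 0).mono_left nhdsWithin_le_nhds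
  simpa using le_of_tendsto_of_tendsto hl hr (eventually_mem_nhdsWithin.mono key)

end Growth

/-! ### The Bergman kernel and its extremal inequality -/

section Bergman

variable {m n : ℕ} {K : Set (Fin m → ℂ)} {Q : (Fin m → ℂ) → ℝ} {τ : Measure (Fin m → ℂ)}

/-- The diagonal `∑_ν |b_ν(z)|²` of the Bergman kernel. -/
noncomputable def bergmanDiagonal (b : MultiIndex m n → MvPolynomial (Fin m) ℂ)
    (z : Fin m → ℂ) : ℝ :=
  ∑ ν, ‖MvPolynomial.eval z (b ν)‖ ^ 2

theorem continuous_bergmanDiagonal (b : MultiIndex m n → MvPolynomial (Fin m) ℂ) :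
    Continuous (bergmanDiagonal b) := by
  unfold bergmanDiagonal
  have := fun ν => (b ν).continuous_eval
  fun_prop

theorem IsOrthonormalBasis.totalDegree_le {b : MultiIndex m n → MvPolynomial (Fin m) ℂ}
    (hb : IsOrthonormalBasis K Q τ n b) (ν : MultiIndex m n) : (b ν).totalDegree ≤ n := by
  rw [← MvPolynomial.mem_restrictTotalDegree, ← hb.span_eq]
  exact Submodule.subset_span ⟨ν, rfl⟩

theorem integrableOn_eval_mul_conj_eval_mul_exp [IsFiniteMeasure τ] (hK : IsCompact K)
    (hQ : ContinuousOn Q K) (p q : MvPolynomial (Fin m) ℂ) :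
    IntegrableOn (fun w => MvPolynomial.eval w p * (starRingEnd ℂ) (MvPolynomial.eval w q) *
      (Real.exp (-(2 * n * Q w)) : ℂ)) K τ := by
  refine ContinuousOn.integrableOn_compact hK ?_
  have hp := p.continuous_eval
  have hq := q.continuous_eval
  fun_prop

theorem integral_norm_sq_mul_exp (p : MvPolynomial (Fin m) ℂ) :
    ((∫ w in K, ‖MvPolynomial.eval w p‖ ^ 2 * Real.exp (-(2 * n * Q w)) ∂τ : ℝ) : ℂ) =
      ∫ w in K, MvPolynomial.eval w p * (starRingEnd ℂ) (MvPolynomial.eval w p) *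
        (Real.exp (-(2 * n * Q w)) : ℂ) ∂τ := by
  rw [← integral_complex_ofReal]
  congr 1 with w
  rw [Complex.mul_conj']
  push_cast
  rfl

theorem IsOrthonormalBasis.integral_norm_sq_sum [IsFiniteMeasure τ] (hK : IsCompact K)
    (hQ : ContinuousOn Q K) {b : MultiIndex m n → MvPolynomial (Fin m) ℂ}
    (hb : IsOrthonormalBasis K Q τ n b) (c : MultiIndex m n → ℂ) :
    ∫ w in K, ‖MvPolynomial.eval w (∑ ν, c ν • b ν)‖ ^ 2 * Real.exp (-(2 * n * Q w)) ∂τ =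
      ∑ ν, ‖c ν‖ ^ 2 := by
  rw [← Complex.ofReal_inj, integral_norm_sq_mul_exp]
  have hexp : ∀ w, MvPolynomial.eval w (∑ ν, c ν • b ν) *
      (starRingEnd ℂ) (MvPolynomial.eval w (∑ ν, c ν • b ν)) *
        (Real.exp (-(2 * n * Q w)) : ℂ) =
      ∑ ν, ∑ γ, c ν * (starRingEnd ℂ) (c γ) * (MvPolynomial.eval w (b ν) *
        (starRingEnd ℂ) (MvPolynomial.eval w (b γ)) * (Real.exp (-(2 * n * Q w)) : ℂ)) := by
    intro w
    simp only [map_sum, MvPolynomial.smul_eval, map_mul]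
    rw [Finset.sum_mul_sum, Finset.sum_mul]
    refine Finset.sum_congr rfl fun ν _ => ?_
    rw [Finset.sum_mul]
    exact Finset.sum_congr rfl fun γ _ => by ring
  have hint : ∀ ν γ, Integrable (fun w => c ν * (starRingEnd ℂ) (c γ) *
      (MvPolynomial.eval w (b ν) * (starRingEnd ℂ) (MvPolynomial.eval w (b γ)) *
        (Real.exp (-(2 * n * Q w)) : ℂ))) (τ.restrict K) := fun ν γ =>
    (integrableOn_eval_mul_conj_eval_mul_exp hK hQ _ _).const_mul _
  simp only [hexp]
  rw [integral_finsetSum _ fun ν _ => integrable_finsetSum _ fun γ _ => hint ν γ,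
    Complex.ofReal_sum]
  refine Finset.sum_congr rfl fun ν _ => ?_
  rw [integral_finsetSum _ fun γ _ => hint ν γ]
  simp only [integral_const_mul, hb.orthonormal]
  simp [Complex.mul_conj']

/-- Expand `p` in the basis; Parseval and Cauchy–Schwarz give the bound. -/
theorem IsOrthonormalBasis.norm_eval_sq_le [IsFiniteMeasure τ] (hK : IsCompact K)
    (hQ : ContinuousOn Q K) {b : MultiIndex m n → MvPolynomial (Fin m) ℂ}
    (hb : IsOrthonormalBasis K Q τ n b) {p : MvPolynomial (Fin m) ℂ} (hp : p.totalDegree ≤ n)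
    (z : Fin m → ℂ) :
    ‖MvPolynomial.eval z p‖ ^ 2 ≤
      (∫ w in K, ‖MvPolynomial.eval w p‖ ^ 2 * Real.exp (-(2 * n * Q w)) ∂τ) *
        bergmanDiagonal b z := by
  rw [← MvPolynomial.mem_restrictTotalDegree, ← hb.span_eq,
    Submodule.mem_span_range_iff_exists_fun] at hp
  obtain ⟨c, rfl⟩ := hp
  rw [hb.integral_norm_sq_sum hK hQ, bergmanDiagonal]
  calc _ ≤ (∑ ν, ‖c ν‖ * ‖MvPolynomial.eval z (b ν)‖) ^ 2 := by
        gcongr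
        rw [map_sum]
        refine (norm_sum_le _ _).trans_eq ?_
        simp [MvPolynomial.smul_eval]
    _ ≤ _ := Finset.sum_mul_sq_le_sq_mul_sq _ _ _

theorem integral_norm_sq_mul_exp_le [IsProbabilityMeasure τ] {p : MvPolynomial (Fin m) ℂ} {D : ℝ}
    (hD : 0 ≤ D)
    (h : ∀ w ∈ K, ‖MvPolynomial.eval w p‖ ^ 2 * Real.exp (-(2 * n * Q w)) ≤ D) :
    ∫ w in K, ‖MvPolynomial.eval w p‖ ^ 2 * Real.exp (-(2 * n * Q w)) ∂τ ≤ D := by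
  have h1 := norm_setIntegral_le_of_norm_le_const (μ := τ) (s := K) (C := D)
    (f := fun w => ‖MvPolynomial.eval w p‖ ^ 2 * Real.exp (-(2 * n * Q w)))
    (measure_lt_top τ K) (fun w hw => by
      rw [Real.norm_of_nonneg (by positivity)]
      exact h w hw)
  exact (Real.le_norm_self _).trans (h1.trans (mul_le_of_le_one_right hD measureReal_le_one))

theorem card_multiIndex_le (m n : ℕ) : Fintype.card (MultiIndex m n) ≤ (n + 1) ^ m := by
  refine (Fintype.card_subtype_le _).trans_eq ?_
  simp

end Bergman

/-! ### Asymptotics of the Bergman kernel -/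

section Asymptotics

variable {m : ℕ} {K : Set (Fin m → ℂ)} {Q V : (Fin m → ℂ) → ℝ} {τ : Measure (Fin m → ℂ)}

/-- Test the extremal inequality with the polynomial `1`. This yields positivity everywhere and,
uniformly in `z`, the lower half of the domination. -/
theorem exp_le_bergmanDiagonal [IsProbabilityMeasure τ] (hK : IsCompact K)
    (hQ : ContinuousOn Q K) {B : ℝ} (hB : ∀ w ∈ K, |Q w| ≤ B) {n : ℕ}
    {b : MultiIndex m n → MvPolynomial (Fin m) ℂ} (hb : IsOrthonormalBasis K Q τ n b)
    (z : Fin m → ℂ) : Real.exp (-(2 * n * B)) ≤ bergmanDiagonal b z := by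
  have h := hb.norm_eval_sq_le hK hQ (p := 1) (by simp) z
  have hI : ∫ w in K, ‖MvPolynomial.eval w (1 : MvPolynomial (Fin m) ℂ)‖ ^ 2 *
      Real.exp (-(2 * n * Q w)) ∂τ ≤ Real.exp (2 * n * B) := by
    refine integral_norm_sq_mul_exp_le (by positivity) fun w hw => ?_
    have := neg_le_of_abs_le (hB w hw)
    simp only [map_one, norm_one, one_pow, one_mul, Real.exp_le_exp]
    nlinarith [(Nat.cast_nonneg n : (0 : ℝ) ≤ n)]
  have h0 : 0 ≤ bergmanDiagonal b z := Finset.sum_nonneg fun _ _ => by positivity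
  rw [map_one, norm_one, one_pow] at h
  rw [Real.exp_neg, inv_le_iff_one_le_mul₀' (Real.exp_pos _)]
  exact h.trans (mul_le_mul_of_nonneg_right hI h0)

theorem bergmanDiagonal_pos [IsProbabilityMeasure τ] (hK : IsCompact K)
    (hQ : ContinuousOn Q K) {n : ℕ} {b : MultiIndex m n → MvPolynomial (Fin m) ℂ}
    (hb : IsOrthonormalBasis K Q τ n b) (z : Fin m → ℂ) : 0 < bergmanDiagonal b z := by
  obtain ⟨B, hB⟩ := hK.exists_bound_of_continuousOn hQ
  exact (Real.exp_pos _).trans_le (exp_le_bergmanDiagonal hK hQ hB hb z)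

theorem neg_le_log_bergmanDiagonal [IsProbabilityMeasure τ] (hK : IsCompact K)
    (hQ : ContinuousOn Q K) {B : ℝ} (hB : ∀ w ∈ K, |Q w| ≤ B) {n : ℕ} (hn : 1 ≤ n)
    {b : MultiIndex m n → MvPolynomial (Fin m) ℂ} (hb : IsOrthonormalBasis K Q τ n b)
    (z : Fin m → ℂ) : -B ≤ Real.log (bergmanDiagonal b z) / (2 * n) := by
  have hn0 : (0 : ℝ) < n := by exact_mod_cast hn
  have h := Real.log_le_log (Real.exp_pos _) (exp_le_bergmanDiagonal hK hQ hB hb z)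
  rw [Real.log_exp] at h
  rw [le_div_iff₀ (by positivity)]
  linarith

theorem WeightedBernsteinMarkov.eventually_le_exp (hBM : WeightedBernsteinMarkov K Q τ)
    {ε : ℝ} (hε : 0 < ε) :
    ∀ᶠ n : ℕ in atTop, ∀ p : MvPolynomial (Fin m) ℂ, p.totalDegree ≤ n → ∀ z ∈ K,
      ‖MvPolynomial.eval z p‖ * Real.exp (-(n * Q z)) ≤ Real.exp (n * ε) *
        Real.sqrt (∫ w in K, ‖MvPolynomial.eval w p‖ ^ 2 * Real.exp (-(2 * n * Q w)) ∂τ) := by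
  obtain ⟨M, hM, h⟩ := hBM
  have hlt : limsup (fun n : ℕ => (M n : ℝ≥0∞) ^ (1 / (n : ℝ))) atTop <
      ENNReal.ofReal (Real.exp ε) := by
    rw [hM, ENNReal.one_lt_ofReal]
    exact Real.one_lt_exp_iff.2 hε
  filter_upwards [eventually_lt_of_limsup_lt hlt, eventually_ge_atTop 1] with n hn hn1 p hp z hz
  refine (h n hn1 p hp z hz).trans (mul_le_mul_of_nonneg_right ?_ (Real.sqrt_nonneg _))
  have hn0 : (0 : ℝ) < n := by exact_mod_cast hn1
  rw [one_div, ENNReal.rpow_inv_lt_iff hn0, ENNReal.ofReal_rpow_of_pos (Real.exp_pos _),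
    ← Real.exp_mul, mul_comm, ← ENNReal.ofReal_coe_nnreal] at hn
  exact ((ENNReal.ofReal_lt_ofReal_iff (Real.exp_pos _)).1 hn).le

/-- Each `b_ν` has norm `1`, so Bernstein–Markov and Bernstein–Walsh give `|b_ν| ≤ e^{n(V + ε/2)}`;
the at most `(n+1)^m` terms cost the other `ε/2`. Uniformity in `z` is needed for domination. -/
theorem eventually_log_bergmanDiagonal_le (hm : 1 ≤ m) (hK : IsCompact K)
    (hQ : ContinuousOn Q K) [IsProbabilityMeasure τ] (hBM : WeightedBernsteinMarkov K Q τ)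
    (hV : ∀ z, extremalFunction K Q z = (V z : EReal))
    {b : (n : ℕ) → MultiIndex m n → MvPolynomial (Fin m) ℂ}
    (hb : ∀ n, 1 ≤ n → IsOrthonormalBasis K Q τ n (b n)) {ε : ℝ} (hε : 0 < ε) :
    ∀ᶠ n : ℕ in atTop, ∀ z, Real.log (bergmanDiagonal (b n) z) / (2 * n) ≤ V z + ε := by
  have hlog : Tendsto (fun n : ℕ => Real.log ((n + 1 : ℕ) : ℝ) / ((n + 1 : ℕ) : ℝ)) atTop
      (𝓝 0) := by
    have := Real.isLittleO_log_id_atTop.tendsto_div_nhds_zero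
    exact (this.comp tendsto_natCast_atTop_atTop).comp (tendsto_add_atTop_nat 1)
  have hsmall : ∀ᶠ n : ℕ in atTop, m * (Real.log ((n + 1 : ℕ) : ℝ) / ((n + 1 : ℕ) : ℝ)) <
      ε / 2 := by
    have := hlog.const_mul (m : ℝ)
    rw [mul_zero] at this
    exact this.eventually_lt_const (by positivity)
  filter_upwards [hBM.eventually_le_exp (half_pos hε), hsmall, eventually_ge_atTop 1]
    with n hn hs hn1 z
  have hn0 : (0 : ℝ) < n := by exact_mod_cast hn1
  have hbν : ∀ ν, ‖MvPolynomial.eval z (b n ν)‖ ≤ Real.exp (n * (V z + ε / 2)) := by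
    intro ν
    have hI : ∫ w in K, ‖MvPolynomial.eval w (b n ν)‖ ^ 2 * Real.exp (-(2 * n * Q w)) ∂τ = 1 := by
      rw [← Complex.ofReal_inj, integral_norm_sq_mul_exp, (hb n hn1).orthonormal]
      simp
    have h1 := norm_eval_le_exp hm hK hQ hV hn1 ((hb n hn1).totalDegree_le ν)
      (C := Real.exp (n * (ε / 2))) (Real.exp_pos _) (fun w hw => by
        have := hn _ ((hb n hn1).totalDegree_le ν) w hw
        rwa [hI, Real.sqrt_one, mul_one] at this) z
    rwa [← Real.exp_add, ← mul_add, add_comm] at h1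
  have hS : bergmanDiagonal (b n) z ≤
      ((n + 1 : ℕ) : ℝ) ^ m * Real.exp (2 * n * (V z + ε / 2)) := by
    calc bergmanDiagonal (b n) z
        ≤ ∑ _ν : MultiIndex m n, Real.exp (2 * n * (V z + ε / 2)) := by
          refine Finset.sum_le_sum fun ν _ => ?_
          rw [mul_assoc, two_mul, Real.exp_add, ← sq]
          gcongr
          exact hbν ν
      _ = (Fintype.card (MultiIndex m n) : ℝ) * Real.exp (2 * n * (V z + ε / 2)) := by simp
      _ ≤ _ := by
          gcongr
          exact_mod_cast card_multiIndex_le m n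
  have hpos := bergmanDiagonal_pos hK hQ (hb n hn1) z
  have h2 := Real.log_le_log hpos hS
  rw [Real.log_mul (by positivity) (Real.exp_pos _).ne', Real.log_pow, Real.log_exp] at h2
  have h3 : m * Real.log ((n + 1 : ℕ) : ℝ) ≤ ε / 2 * ((n + 1 : ℕ) : ℝ) := by
    rw [← mul_div_assoc, div_lt_iff₀ (by positivity)] at hs
    exact hs.le
  have h4 : ((n + 1 : ℕ) : ℝ) ≤ 2 * n := by
    have : (1 : ℝ) ≤ n := by exact_mod_cast hn1
    push_cast
    linarith
  rw [div_le_iff₀ (by positivity)]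
  nlinarith [mul_le_mul_of_nonneg_left h4 (half_pos hε).le]

/-- Choose a competitor `p` of degree `d` whose value at `z` exceeds `v`, and test the extremal
inequality with `p^k`, `k = ⌊n/d⌋`. The remainder of the division costs only `O(1/n)`. -/
theorem eventually_lt_log_bergmanDiagonal (hK : IsCompact K) (hQ : ContinuousOn Q K)
    [IsProbabilityMeasure τ] (hV : ∀ z, extremalFunction K Q z = (V z : EReal))
    {b : (n : ℕ) → MultiIndex m n → MvPolynomial (Fin m) ℂ}
    (hb : ∀ n, 1 ≤ n → IsOrthonormalBasis K Q τ n (b n)) {z : Fin m → ℂ} {v : ℝ}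
    (hv : v < V z) :
    ∀ᶠ n : ℕ in atTop, v < Real.log (bergmanDiagonal (b n) z) / (2 * n) := by
  obtain ⟨B, hB⟩ := hK.exists_bound_of_continuousOn hQ
  have hv' : (v : EReal) < extremalFunction K Q z := by rw [hV]; exact_mod_cast hv
  simp only [extremalFunction, lt_iSup_iff] at hv'
  obtain ⟨p, hd, hpK, hvp⟩ := hv'
  set d := p.totalDegree with hd_def
  have hd0 : (0 : ℝ) < d := by exact_mod_cast hd
  have hpz : MvPolynomial.eval z p ≠ 0 := by
    intro h0
    rw [h0, enorm_zero, ENNReal.log_zero, EReal.bot_div_of_pos_ne_top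
      (by exact_mod_cast hd) (by exact EReal.natCast_ne_top d)] at hvp
    exact not_lt_bot hvp
  rw [ENNReal.log_enorm_div_natCast hpz, EReal.coe_lt_coe_iff] at hvp
  set l := Real.log ‖MvPolynomial.eval z p‖ with hl
  have key : ∀ n : ℕ, 1 ≤ n →
      l / d - (|l| + d * |B|) * (1 / (n : ℝ)) ≤ Real.log (bergmanDiagonal (b n) z) / (2 * n) := by
    intro n hn1
    have hn0 : (0 : ℝ) < n := by exact_mod_cast hn1
    set k := n / d
    set r := n % d
    have hkr : (n : ℝ) = d * k + r := by exact_mod_cast (Nat.div_add_mod n d).symm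
    have hrd : (r : ℝ) ≤ d := by exact_mod_cast (Nat.mod_lt n hd).le
    have hr0 : (0 : ℝ) ≤ r := Nat.cast_nonneg r
    have hdeg : (p ^ k).totalDegree ≤ n :=
      (MvPolynomial.totalDegree_pow p k).trans (Nat.div_mul_le_self n d)
    have hI : ∫ w in K, ‖MvPolynomial.eval w (p ^ k)‖ ^ 2 * Real.exp (-(2 * n * Q w)) ∂τ ≤
        Real.exp (2 * (d * |B|)) := by
      refine integral_norm_sq_mul_exp_le (Real.exp_pos _).le fun w hw => ?_
      have e : ‖MvPolynomial.eval w (p ^ k)‖ ^ 2 * Real.exp (-(2 * n * Q w)) =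
          ((‖MvPolynomial.eval w p‖ * Real.exp (-(d * Q w))) ^ k) ^ 2 *
            Real.exp (-(2 * (r * Q w))) := by
        rw [map_pow, norm_pow, mul_pow, mul_pow, ← Real.exp_nat_mul, ← Real.exp_nat_mul,
          mul_assoc ((_ ^ k) ^ 2), ← Real.exp_add, hkr]
        congr 2
        push_cast
        ring
      rw [e]
      -- Of the weight `e^{-2nQ}`, the powers of `p` absorb `e^{-2dkQ}`; the factor `e^{-2rQ}` with
      -- `r ≤ d` is left.
      calc _ ≤ (1 ^ k) ^ 2 * Real.exp (2 * (d * |B|)) := by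
            gcongr
            · exact hpK w hw
            · have h1 : -Q w ≤ |B| := (neg_le_abs _).trans ((hB w hw).trans (le_abs_self B))
              have h2 := mul_le_mul_of_nonneg_left h1 hr0
              have h3 := mul_le_mul_of_nonneg_right hrd (abs_nonneg B)
              linarith
        _ = _ := by simp
    have hS := bergmanDiagonal_pos hK hQ (hb n hn1) z
    have h1 := ((hb n hn1).norm_eval_sq_le hK hQ hdeg z).trans
      (mul_le_mul_of_nonneg_right hI hS.le)
    have h2 := Real.log_le_log (by have := norm_pos_iff.2 hpz; rw [map_pow, norm_pow]; positivity) h1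
    rw [Real.log_mul (Real.exp_pos _).ne' hS.ne', Real.log_exp, map_pow, norm_pow, Real.log_pow,
      Real.log_pow, ← hl] at h2
    push_cast at h2
    have h3 : (k : ℝ) * l = n * (l / d) - r * l / d := by
      rw [hkr]
      field_simp
      ring
    have h4 : r * l / d ≤ |l| := by
      rw [div_le_iff₀ hd0]
      nlinarith [le_abs_self l, abs_nonneg l]
    have h5 : (l / d - (|l| + d * |B|) * (1 / (n : ℝ))) * (2 * n) =
        2 * (n * (l / d)) - 2 * (|l| + d * |B|) := by
      field_simp
    rw [le_div_iff₀ (by positivity), h5]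
    linarith
  have hlim : Tendsto (fun n : ℕ => l / d - (|l| + d * |B|) * (1 / (n : ℝ))) atTop
      (𝓝 (l / d)) := by
    simpa using (tendsto_one_div_atTop_nhds_zero_nat.const_mul (|l| + d * |B|)).const_sub (l / d)
  filter_upwards [hlim.eventually_const_lt hvp, eventually_ge_atTop 1] with n hn hn1
  exact hn.trans_le (key n hn1)

theorem tendsto_log_bergmanDiagonal (hm : 1 ≤ m) (hK : IsCompact K)
    (hQ : ContinuousOn Q K) [IsProbabilityMeasure τ] (hBM : WeightedBernsteinMarkov K Q τ)
    (hV : ∀ z, extremalFunction K Q z = (V z : EReal))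
    {b : (n : ℕ) → MultiIndex m n → MvPolynomial (Fin m) ℂ}
    (hb : ∀ n, 1 ≤ n → IsOrthonormalBasis K Q τ n (b n)) (z : Fin m → ℂ) :
    Tendsto (fun n : ℕ => Real.log (bergmanDiagonal (b n) z) / (2 * n)) atTop (𝓝 (V z)) := by
  refine tendsto_order.2 ⟨fun v hv => eventually_lt_log_bergmanDiagonal hK hQ hV hb hv,
    fun v hv => ?_⟩
  filter_upwards [eventually_log_bergmanDiagonal_le hm hK hQ hBM hV hb
    (half_pos (sub_pos.2 hv))] with n hn
  linarith [hn z]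

end Asymptotics

/-! ### Smoothness and support of `dd^c α` -/

section Forms

variable {m k : ℕ}

theorem contDiff_extDeriv {α : (Fin m → ℂ) → Form m k} (hα : ContDiff ℝ ∞ α) :
    ContDiff ℝ ∞ (extDeriv α) :=
  (ContinuousAlternatingMap.alternatizeUncurryFinCLM ℝ (Fin m → ℂ) ℂ).contDiff.comp
    (hα.fderiv_right (by simp))

theorem hasCompactSupport_extDeriv {α : (Fin m → ℂ) → Form m k} (hα : HasCompactSupport α) :
    HasCompactSupport (extDeriv α) :=
  (hα.fderiv (𝕜 := ℝ)).comp_left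
    (g := ContinuousAlternatingMap.alternatizeUncurryFinCLM ℝ (Fin m → ℂ) ℂ) (map_zero _)

theorem continuous_ddc_apply {α : (Fin m → ℂ) → Form m k} (hα : ContDiff ℝ ∞ α)
    (v : Fin (k + 1 + 1) → Fin m → ℂ) : Continuous fun z => ddc α z v := by
  have h : ContDiff ℝ ∞ fun w => (extDeriv α w).compContinuousLinearMap (mulI m) :=
    (ContinuousAlternatingMap.compContinuousLinearMapCLM (mulI m) :
      Form m (k + 1) →L[ℝ] Form m (k + 1)).contDiff.comp (contDiff_extDeriv hα)
  have h' : Continuous (ddc α) :=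
    (contDiff_extDeriv h).continuous.const_smul (-(1 / (2 * Real.pi)) : ℝ)
  exact (ContinuousAlternatingMap.apply ℝ (Fin m → ℂ) ℂ v).continuous.comp h'

theorem hasCompactSupport_ddc_apply {α : (Fin m → ℂ) → Form m k} (hα : HasCompactSupport α)
    (v : Fin (k + 1 + 1) → Fin m → ℂ) : HasCompactSupport fun z => ddc α z v := by
  have h : HasCompactSupport fun w => (extDeriv α w).compContinuousLinearMap (mulI m) :=
    (hasCompactSupport_extDeriv hα).comp_left
      (g := ContinuousAlternatingMap.compContinuousLinearMapCLM (mulI m)) (map_zero _)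
  exact (hasCompactSupport_extDeriv h).comp_left
    (g := fun η : Form m (k + 1 + 1) => ((-(1 / (2 * Real.pi)) : ℝ) • η) v) (by simp)

end Forms

/-! ### Logarithms of random polynomials -/

section RandomPolynomial

variable {m n : ℕ} {b : MultiIndex m n → MvPolynomial (Fin m) ℂ} {Ω : Type*} [MeasurableSpace Ω]
  {P : Measure Ω} [IsProbabilityMeasure P] {a : MultiIndex m n → Ω → ℝ}

theorem measurable_log_norm_polySum (ha_meas : ∀ ν, Measurable (a ν)) :
    Measurable fun q : (Fin m → ℂ) × Ω => Real.log ‖polySum b (fun ν => a ν q.2) q.1‖ := by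
  have hb := fun ν => (b ν).continuous_eval.measurable
  unfold polySum
  fun_prop

theorem integrable_log_norm_polySum (ha_meas : ∀ ν, Measurable (a ν)) (ha_indep : iIndepFun a P)
    (ha_law : ∀ ν, P.map (a ν) = gaussianLaw) {z : Fin m → ℂ} (hz : 0 < bergmanDiagonal b z) :
    Integrable (fun x => Real.log ‖polySum b (fun ν => a ν x) z‖) P :=
  (integral_abs_log_norm_sum_sub_le ha_meas ha_indep ha_law _ hz).1

theorem integral_abs_log_norm_polySum_sub_le (ha_meas : ∀ ν, Measurable (a ν))
    (ha_indep : iIndepFun a P) (ha_law : ∀ ν, P.map (a ν) = gaussianLaw) {z : Fin m → ℂ}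
    (hz : 0 < bergmanDiagonal b z) :
    ∫ x, |Real.log ‖polySum b (fun ν => a ν x) z‖ - 1 / 2 * Real.log (bergmanDiagonal b z)| ∂P ≤
      logGaussianBound :=
  (integral_abs_log_norm_sum_sub_le ha_meas ha_indep ha_law _ hz).2

theorem abs_integral_log_norm_polySum_sub_le (ha_meas : ∀ ν, Measurable (a ν))
    (ha_indep : iIndepFun a P) (ha_law : ∀ ν, P.map (a ν) = gaussianLaw) {z : Fin m → ℂ}
    (hz : 0 < bergmanDiagonal b z) :
    |∫ x, Real.log ‖polySum b (fun ν => a ν x) z‖ ∂P - 1 / 2 * Real.log (bergmanDiagonal b z)| ≤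
      logGaussianBound := by
  have h := integrable_log_norm_polySum ha_meas ha_indep ha_law hz
  refine le_trans ?_ (integral_abs_log_norm_polySum_sub_le ha_meas ha_indep ha_law hz)
  refine le_trans (le_of_eq ?_) (abs_integral_le_integral_abs)
  rw [integral_sub h (integrable_const _)]
  simp

/-- Tonelli: the expected `|log|H||` is bounded by a continuous function of `z`. Both almost sure
local integrability and the exchange of integrals rest on this. -/
theorem integrable_log_norm_polySum_prod (ha_meas : ∀ ν, Measurable (a ν))
    (ha_indep : iIndepFun a P) (ha_law : ∀ ν, P.map (a ν) = gaussianLaw)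
    (hpos : ∀ z, 0 < bergmanDiagonal b z) {T : Set (Fin m → ℂ)} (hT : IsCompact T) :
    Integrable (fun q : (Fin m → ℂ) × Ω => Real.log ‖polySum b (fun ν => a ν q.2) q.1‖)
      ((volume.restrict T).prod P) := by
  have hmeas := measurable_log_norm_polySum (b := b) ha_meas
  refine (integrable_prod_iff hmeas.aestronglyMeasurable).2
    ⟨ae_of_all _ fun z => integrable_log_norm_polySum ha_meas ha_indep ha_law (hpos z), ?_⟩
  have hcont : Continuous fun z =>
      logGaussianBound + |1 / 2 * Real.log (bergmanDiagonal b z)| :=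
    continuous_const.add (continuous_const.mul
      ((continuous_bergmanDiagonal b).log fun z => (hpos z).ne')).abs
  refine (hcont.continuousOn.integrableOn_compact hT).mono'
    hmeas.norm.aestronglyMeasurable.integral_prod_right' (ae_of_all _ fun z => ?_)
  have h := integrable_log_norm_polySum ha_meas ha_indep ha_law (hpos z)
  have h1 : Integrable (fun x => |Real.log ‖polySum b (fun ν => a ν x) z‖ -
      1 / 2 * Real.log (bergmanDiagonal b z)|) P := (h.sub (integrable_const _)).abs
  rw [Real.norm_of_nonneg (integral_nonneg fun _ => norm_nonneg _)]
  calc ∫ x, ‖Real.log ‖polySum b (fun ν => a ν x) z‖‖ ∂P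
      ≤ ∫ x, (|Real.log ‖polySum b (fun ν => a ν x) z‖ - 1 / 2 * Real.log (bergmanDiagonal b z)| +
          |1 / 2 * Real.log (bergmanDiagonal b z)|) ∂P := by
        refine integral_mono h.norm (h1.add (integrable_const _)) fun x => ?_
        exact sub_le_iff_le_add.1 (abs_sub_abs_le_abs_sub _ _)
    _ ≤ _ := by
        rw [integral_add h1 (integrable_const _)]
        refine add_le_add (integral_abs_log_norm_polySum_sub_le ha_meas ha_indep ha_law (hpos z)) ?_
        simp

theorem ae_locallyIntegrable_log_norm_polySum (ha_meas : ∀ ν, Measurable (a ν))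
    (ha_indep : iIndepFun a P) (ha_law : ∀ ν, P.map (a ν) = gaussianLaw)
    (hpos : ∀ z, 0 < bergmanDiagonal b z) :
    ∀ᵐ x ∂P,
      LocallyIntegrable (fun z => Real.log ‖polySum b (fun ν => a ν x) z‖) volume := by
  -- Countably many balls exhaust the space, so one null set serves all compact sets.
  have h : ∀ᵐ x ∂P, ∀ k : ℕ, IntegrableOn
      (fun z => Real.log ‖polySum b (fun ν => a ν x) z‖) (Metric.closedBall 0 k) volume :=
    ae_all_iff.2 fun k => (integrable_log_norm_polySum_prod ha_meas ha_indep ha_law hpos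
      (isCompact_closedBall 0 (k : ℝ))).prod_left_ae
  filter_upwards [h] with x hx
  refine locallyIntegrable_iff.2 fun T hT => ?_
  obtain ⟨R, hR⟩ := hT.isBounded.subset_closedBall 0
  obtain ⟨k, hk⟩ := exists_nat_ge R
  exact (hx k).mono_set (hR.trans (Metric.closedBall_subset_closedBall hk))

variable {g : (Fin m → ℂ) → ℂ}

theorem integrable_log_norm_polySum_mul_prod (ha_meas : ∀ ν, Measurable (a ν))
    (ha_indep : iIndepFun a P) (ha_law : ∀ ν, P.map (a ν) = gaussianLaw)
    (hpos : ∀ z, 0 < bergmanDiagonal b z) (hg : Continuous g) (hgs : HasCompactSupport g) :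
    Integrable (fun q : (Fin m → ℂ) × Ω =>
      (Real.log ‖polySum b (fun ν => a ν q.2) q.1‖ : ℂ) * g q.1) (volume.prod P) := by
  obtain ⟨C, hC⟩ := hg.bounded_above_of_compact_support hgs
  have h := (integrable_log_norm_polySum_prod ha_meas ha_indep ha_law hpos hgs).ofReal (𝕜 := ℂ)
  have h1 := h.mul_bdd (g := fun q : (Fin m → ℂ) × Ω => g q.1) (c := C)
    (hg.measurable.comp measurable_fst).aestronglyMeasurable (ae_of_all _ fun q => hC q.1)
  rw [← Measure.restrict_univ (μ := P), Measure.prod_restrict, ← IntegrableOn,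
    integrableOn_iff_integrable_of_support_subset] at h1
  · exact h1
  · intro q hq
    exact ⟨subset_tsupport _ (right_ne_zero_of_mul hq), Set.mem_univ _⟩

theorem integral_integral_log_norm_polySum_mul (ha_meas : ∀ ν, Measurable (a ν))
    (ha_indep : iIndepFun a P) (ha_law : ∀ ν, P.map (a ν) = gaussianLaw)
    (hpos : ∀ z, 0 < bergmanDiagonal b z) (hg : Continuous g) (hgs : HasCompactSupport g) :
    ∫ x, (∫ z, (Real.log ‖polySum b (fun ν => a ν x) z‖ : ℂ) * g z) ∂P =
      ∫ z, ((∫ x, Real.log ‖polySum b (fun ν => a ν x) z‖ ∂P : ℝ) : ℂ) * g z := by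
  rw [← integral_integral_swap (integrable_log_norm_polySum_mul_prod ha_meas ha_indep ha_law hpos
    hg hgs)]
  congr 1 with z
  rw [integral_mul_const, integral_complex_ofReal]

end RandomPolynomial

/-! ### Passage to the limit -/

section Convergence

variable {m : ℕ} {K : Set (Fin m → ℂ)} {Q V : (Fin m → ℂ) → ℝ} {τ : Measure (Fin m → ℂ)}
  [IsProbabilityMeasure τ] {Ω : Type*} [MeasurableSpace Ω] {P : Measure Ω}
  [IsProbabilityMeasure P] {b : (n : ℕ) → MultiIndex m n → MvPolynomial (Fin m) ℂ}
  {a : (n : ℕ) → MultiIndex m n → Ω → ℝ}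

theorem abs_integral_log_norm_polySum_div_sub_le (ha_meas : ∀ n ν, Measurable (a n ν))
    (ha_indep : ∀ n, iIndepFun (a n) P) (ha_law : ∀ n ν, P.map (a n ν) = gaussianLaw)
    {n : ℕ} {z : Fin m → ℂ} (hz : 0 < bergmanDiagonal (b n) z) :
    |(∫ x, Real.log ‖polySum (b n) (fun ν => a n ν x) z‖ ∂P) / n -
      Real.log (bergmanDiagonal (b n) z) / (2 * n)| ≤ logGaussianBound / n := by
  have h := div_le_div_of_nonneg_right
    (abs_integral_log_norm_polySum_sub_le (ha_meas n) (ha_indep n) (ha_law n) hz)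
    (Nat.cast_nonneg (α := ℝ) n)
  refine le_trans (le_of_eq ?_) h
  rw [← Nat.abs_cast n, ← abs_div, Nat.abs_cast, sub_div]
  congr 2
  rw [mul_comm (2 : ℝ), ← div_div]
  ring

theorem tendsto_integral_log_norm_polySum_div (hm : 1 ≤ m) (hK : IsCompact K)
    (hQ : ContinuousOn Q K) (hBM : WeightedBernsteinMarkov K Q τ)
    (hV : ∀ z, extremalFunction K Q z = (V z : EReal))
    (hb : ∀ n, 1 ≤ n → IsOrthonormalBasis K Q τ n (b n)) (ha_meas : ∀ n ν, Measurable (a n ν))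
    (ha_indep : ∀ n, iIndepFun (a n) P) (ha_law : ∀ n ν, P.map (a n ν) = gaussianLaw)
    (z : Fin m → ℂ) :
    Tendsto (fun n : ℕ => (∫ x, Real.log ‖polySum (b n) (fun ν => a n ν x) z‖ ∂P) / n) atTop
      (𝓝 (V z)) := by
  have h1 : Tendsto (fun n : ℕ => (∫ x, Real.log ‖polySum (b n) (fun ν => a n ν x) z‖ ∂P) / n -
      Real.log (bergmanDiagonal (b n) z) / (2 * n)) atTop (𝓝 0) := by
    refine squeeze_zero_norm' ?_ (tendsto_const_div_atTop_nhds_zero_nat logGaussianBound)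
    filter_upwards [eventually_ge_atTop 1] with n hn
    exact abs_integral_log_norm_polySum_div_sub_le ha_meas ha_indep ha_law
      (bergmanDiagonal_pos hK hQ (hb n hn) z)
  simpa using h1.add (tendsto_log_bergmanDiagonal hm hK hQ hBM hV hb z)

theorem logGaussianBound_nonneg : 0 ≤ logGaussianBound := by
  have h1 : 0 ≤ ∫ y, |Real.log y| ∂gaussianLaw := integral_nonneg fun _ => abs_nonneg _
  have h2 : 0 ≤ Real.log 2 := Real.log_nonneg (by norm_num)
  unfold logGaussianBound
  linarith

/-- Dominated convergence: `(1/2n) log S_n` lies between `-B` and, eventually, `V + 1`, and the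
Gaussian error is at most `logGaussianBound`. -/
theorem tendsto_integral_integral_log_norm_polySum_div_mul (hm : 1 ≤ m) (hK : IsCompact K)
    (hQ : ContinuousOn Q K) (hBM : WeightedBernsteinMarkov K Q τ)
    (hV : ∀ z, extremalFunction K Q z = (V z : EReal)) (hVcont : Continuous V)
    (hb : ∀ n, 1 ≤ n → IsOrthonormalBasis K Q τ n (b n)) (ha_meas : ∀ n ν, Measurable (a n ν))
    (ha_indep : ∀ n, iIndepFun (a n) P) (ha_law : ∀ n ν, P.map (a n ν) = gaussianLaw)
    {g : (Fin m → ℂ) → ℂ} (hg : Continuous g) (hgs : HasCompactSupport g) :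
    Tendsto (fun n : ℕ => ∫ z,
      (((∫ x, Real.log ‖polySum (b n) (fun ν => a n ν x) z‖ ∂P) / n : ℝ) : ℂ) * g z) atTop
      (𝓝 (∫ z, (V z : ℂ) * g z)) := by
  obtain ⟨B, hB⟩ := hK.exists_bound_of_continuousOn hQ
  have hbd : Integrable fun z => (logGaussianBound + (|B| + (|V z| + 1))) * ‖g z‖ :=
    Continuous.integrable_of_hasCompactSupport (by fun_prop) hgs.norm.mul_left
  refine tendsto_integral_filter_of_dominated_convergence _ (Eventually.of_forall fun n => ?_) ?_
    hbd (ae_of_all _ fun z => ?_)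
  · have h : StronglyMeasurable fun z =>
        ∫ x, Real.log ‖polySum (b n) (fun ν => a n ν x) z‖ ∂P :=
      (measurable_log_norm_polySum (b := b n) (ha_meas
        n)).stronglyMeasurable.integral_prod_right'
    have h' := h.measurable
    exact Measurable.aestronglyMeasurable (by fun_prop)
  · filter_upwards [eventually_log_bergmanDiagonal_le hm hK hQ hBM hV hb one_pos,
      eventually_ge_atTop 1] with n hn hn1
    refine ae_of_all _ fun z => ?_
    have h1 := abs_integral_log_norm_polySum_div_sub_le (z := z) ha_meas ha_indep ha_law
      (bergmanDiagonal_pos hK hQ (hb n hn1) z)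
    have h2 := neg_le_log_bergmanDiagonal hK hQ hB hn1 (hb n hn1) z
    have h3 : logGaussianBound / n ≤ logGaussianBound :=
      div_le_self logGaussianBound_nonneg (by exact_mod_cast hn1)
    have h4 : |Real.log (bergmanDiagonal (b n) z) / (2 * n)| ≤ |B| + (|V z| + 1) := by
      have := hn z
      rw [abs_le]
      constructor <;> linarith [le_abs_self B, abs_nonneg B, le_abs_self (V z), abs_nonneg (V z)]
    rw [norm_mul, Complex.norm_real, Real.norm_eq_abs]
    gcongr
    exact (sub_le_iff_le_add.1 (abs_sub_abs_le_abs_sub _ _)).trans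
      (add_le_add (h1.trans h3) h4)
  · exact ((Complex.continuous_ofReal.tendsto _).comp (tendsto_integral_log_norm_polySum_div hm hK
      hQ hBM hV hb ha_meas ha_indep ha_law z)).mul_const _

end Convergence

end ExpectedZeros

open ExpectedZeros
theorem mainTheorem11 {m : ℕ} (hm : 1 ≤ m)
    (K : Set (Fin m → ℂ)) (hK : IsCompact K)
    (Q : (Fin m → ℂ) → ℝ) (hQ : ContinuousOn Q K)
    (τ : Measure (Fin m → ℂ)) [IsProbabilityMeasure τ] (hτ : τ Kᶜ = 0)
    (hBM : WeightedBernsteinMarkov K Q τ)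
    (V : (Fin m → ℂ) → ℝ) (hV : ∀ z, extremalFunction K Q z = (V z : EReal))
    (hVcont : Continuous V)
    (b : (n : ℕ) → MultiIndex m n → MvPolynomial (Fin m) ℂ)
    (hb : ∀ n, 1 ≤ n → IsOrthonormalBasis K Q τ n (b n))
    {Ω : Type*} [MeasurableSpace Ω] (P : Measure Ω) [IsProbabilityMeasure P]
    (a : (n : ℕ) → MultiIndex m n → Ω → ℝ)
    (ha_meas : ∀ n ν, Measurable (a n ν))
    (ha_indep : iIndepFun (fun i : (n : ℕ) × MultiIndex m n => a i.1 i.2) P)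
    (ha_law : ∀ n ν, P.map (a n ν) = gaussianLaw) :
    (∀ n, 1 ≤ n → ∀ᵐ x ∂P,
      LocallyIntegrable (fun z => Real.log ‖polySum (b n) (fun ν => a n ν x) z‖) volume) ∧
    (∀ n, 1 ≤ n → ∀ α : TestForm m (m - 1) (m - 1),
      Integrable (fun x => normalizedZeroCurrent n (polySum (b n) (fun ν => a n ν x)) α) P) ∧
    (∀ α : TestForm m (m - 1) (m - 1),
      Tendsto
        (fun n => expectedNormalizedZeroCurrent P n
          (fun x => polySum (b n) (fun ν => a n ν x)) α)
        atTop (𝓝 (ddcCurrent V α))) := by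
  have hind : ∀ n, iIndepFun (a n) P := fun n =>
    ha_indep.precomp (g := fun ν : MultiIndex m n => (⟨n, ν⟩ : (n : ℕ) × MultiIndex m n))
      sigma_mk_injective
  have hpos : ∀ n, 1 ≤ n → ∀ z, 0 < bergmanDiagonal (b n) z := fun n hn z =>
    bergmanDiagonal_pos hK hQ (hb n hn) z
  refine ⟨fun n hn => ae_locallyIntegrable_log_norm_polySum (ha_meas n) (hind n) (ha_law n)
    (hpos n hn), fun n hn α => ?_, fun α => ?_⟩
  · exact (integrable_log_norm_polySum_mul_prod (ha_meas n) (hind n) (ha_law n) (hpos n hn)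
      (continuous_ddc_apply α.smooth _)
      (hasCompactSupport_ddc_apply α.compactSupport _)).integral_prod_right.const_mul _
  · have hg := continuous_ddc_apply α.smooth (frame m _)
    have hgs := hasCompactSupport_ddc_apply α.compactSupport (frame m _)
    refine (tendsto_integral_integral_log_norm_polySum_div_mul hm hK hQ hBM hV hVcont hb ha_meas
      hind ha_law hg hgs).congr' ?_
    -- Fubini needs `S_n > 0`, which is known only for `n ≥ 1`.
    filter_upwards [eventually_ge_atTop 1] with n hn
    unfold expectedNormalizedZeroCurrent normalizedZeroCurrent ddcCurrent
    rw [integral_const_mul, integral_integral_log_norm_polySum_mul (ha_meas n) (hind n) (ha_law n)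
      (hpos n hn) hg hgs, ← integral_const_mul]
    congr 1 with z
    push_cast
    ring
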